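/- All Banach spaces are real. For Banach spaces $X,Y$ and $\varepsilon\ge 0$, a map $f:X\to Y$ is a standard $\varepsilon$-isometry if $f(0)=0$ and $\bigl|\,\|f(x)-f(y)\|-\|x-y\|\,\bigr|\le\varepsilon$ for all $x,y\in X$; let $L(f)=\overline{\operatorname{span}}\,f(X)\subseteq Y$. A Banach space $Z$ is called injective if there is $\lambda\ge 1$ such that every bounded linear operator $T:F\to Z$ from a closed subspace $F$ of a Banach space $E$ extends to a bounded linear operator $S:E\to Z$ with $\|S\|\le\lambda\|T\|$. Theorem. Let $X$ be a Banach space such that for every Banach space $Y$, every $\varepsilon\ge 0$ and every standard $\varepsilon$-isometry $f:X\to Y$ there exist $\gamma>0$ and a bounded linear operator $T:L(f)\to X$ (both possibly depending on $Y$, $\varepsilon$ and $f$) satisfying $$\|Tf(x)-x\|\le\gamma\varepsilon\qquad\text{for all }x\in X.$$ Then $X^{**}$ is injective. If, in addition, $X$ is isomorphic (linearly homeomorphic) to the dual $M^*$ of a Banach space $M$, then $X$ is injective. -/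

import Mathlib

universe u v w

/-- `f : X → Y` is a standard `ε`-isometry: `f 0 = 0` and
`|‖f x - f y‖ - ‖x - y‖| ≤ ε` for all `x y`, where `ε ≥ 0`. No linearity or continuity
of `f` is required. -/
structure IsStandardEpsIsometry {X : Type u} {Y : Type v}
    [NormedAddCommGroup X] [NormedAddCommGroup Y] (ε : ℝ) (f : X → Y) : Prop where
  eps_nonneg : 0 ≤ ε
  map_zero : f 0 = 0
  abs_sub_le : ∀ x y : X, |‖f x - f y‖ - ‖x - y‖| ≤ ε

/-- `L(f)`, the closed linear span of the range of `f`. -/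
def closedSpanRange {X : Type u} {Y : Type v}
    [NormedAddCommGroup Y] [NormedSpace ℝ Y] (f : X → Y) : Submodule ℝ Y :=
  (Submodule.span ℝ (Set.range f)).topologicalClosure

theorem mem_closedSpanRange {X : Type u} {Y : Type v}
    [NormedAddCommGroup Y] [NormedSpace ℝ Y] (f : X → Y) (x : X) :
    f x ∈ closedSpanRange f :=
  Submodule.le_topologicalClosure _ (Submodule.subset_span (Set.mem_range_self x))

/-- `X` is universally left-stable: for every Banach space `Y`, every `ε ≥ 0` and every standard
`ε`-isometry `f : X → Y` there are `γ > 0` and a bounded linear `T : L(f) → X` with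
`‖T (f x) - x‖ ≤ γ ε` for all `x`. Both `γ` and `T` may depend on `Y`, `ε` and `f`. -/
def IsUniversallyLeftStable (X : Type u) [NormedAddCommGroup X] [NormedSpace ℝ X] : Prop :=
  ∀ (Y : Type u) [NormedAddCommGroup Y] [NormedSpace ℝ Y] [CompleteSpace Y]
    (ε : ℝ) (f : X → Y), IsStandardEpsIsometry ε f →
      ∃ γ : ℝ, 0 < γ ∧ ∃ T : closedSpanRange f →L[ℝ] X,
        ∀ x : X, ‖T ⟨f x, mem_closedSpanRange f x⟩ - x‖ ≤ γ * ε

/-- `X` is `lam`-injective: every bounded linear operator `T` from a closed subspace `F` of a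
Banach space `E` into `X` extends to a bounded linear operator on `E` of norm at most
`lam * ‖T‖`. -/
def IsLambdaInjective (lam : ℝ) (X : Type u) [NormedAddCommGroup X] [NormedSpace ℝ X] : Prop :=
  ∀ (E : Type v) [NormedAddCommGroup E] [NormedSpace ℝ E] [CompleteSpace E]
    (F : Submodule ℝ E), IsClosed (F : Set E) → ∀ T : F →L[ℝ] X,
      ∃ S : E →L[ℝ] X, (∀ z : F, S (z : E) = T z) ∧ ‖S‖ ≤ lam * ‖T‖

/-- `X` is injective: it is `lam`-injective for some `lam ≥ 1`. The universe `v` is that of the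
spaces from which operators are extended. -/
def IsInjectiveBanach (X : Type u) [NormedAddCommGroup X] [NormedSpace ℝ X] : Prop :=
  ∃ lam : ℝ, 1 ≤ lam ∧ IsLambdaInjective.{u, v} lam X

/-- `X` is isomorphic (linearly homeomorphic) to the dual `M*` of some Banach space `M`. -/
def IsIsomorphicToDual (X : Type u) [NormedAddCommGroup X] [NormedSpace ℝ X] : Prop :=
  ∃ (M : Type w) (_ : NormedAddCommGroup M) (_ : NormedSpace ℝ M) (_ : CompleteSpace M),
    Nonempty (X ≃L[ℝ] StrongDual ℝ M)

/-! If `i` embeds `X` isometrically in `W` and `g : X → W` is bounded with `g 0 = 0`, then `i + g`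
is a standard ε-isometry. Rescaling, `(i + g)(n x) / n → i x`, so the stability operator is an exact
left inverse of `i`, on a subspace that also contains the range of `g` (`exists_leftInverse`).
Letting `g` run through countably many vectors yields one constant for all finite enlargements of `i
X` (`exists_uniform_leftInverse`). Take `W = ℓ^∞(Γ)`, which is 1-injective: operators into `X`
extend to finite-dimensional spaces with uniform bounds. For an operator into `X**`, local
reflexivity (`exists_approx_of_bidual`) replaces its finite-dimensional restrictions by operators
into `X`; these are extended, and a weak* ultralimit gives the extension. A dual space is
complemented in its bidual, hence the second claim. -/

section

open Filter Topology

set_option maxSynthPendingDepth 3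

/-! ### Injectivity of `ℓ^∞` and the canonical embedding into it. -/

section LpInfty

variable {Γ : Type*} {E : Type*} [NormedAddCommGroup E] [NormedSpace ℝ E]

/-- A uniformly bounded family of functionals, as one operator into `ℓ^∞`. -/
noncomputable def boundedFamilyToLpInfty (g : Γ → StrongDual ℝ E) (C : ℝ) (hC : ∀ i, ‖g i‖ ≤ C) :
    E →L[ℝ] lp (fun _ : Γ => ℝ) ⊤ :=
  LinearMap.mkContinuous
    { toFun := fun e => ⟨fun i => g i e, memℓp_infty ⟨C * ‖e‖, by
        rintro _ ⟨i, rfl⟩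
        exact (g i).le_of_opNorm_le (hC i) e⟩⟩
      map_add' := fun a b => by ext i; exact (g i).map_add a b
      map_smul' := fun c a => by ext i; exact (g i).map_smul c a }
    (max C 0) (fun e => lp.norm_le_of_forall_le (by positivity) fun i =>
      (g i).le_of_opNorm_le ((hC i).trans (le_max_left _ _)) e)

@[simp]
theorem boundedFamilyToLpInfty_apply (g : Γ → StrongDual ℝ E) (C : ℝ) (hC : ∀ i, ‖g i‖ ≤ C)
    (e : E) (i : Γ) : boundedFamilyToLpInfty g C hC e i = g i e := rfl

/-- `ℓ^∞` is `1`-injective. -/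
theorem exists_extension_lpInfty (H : Submodule ℝ E) (S : H →L[ℝ] lp (fun _ : Γ => ℝ) ⊤) :
    ∃ R : E →L[ℝ] lp (fun _ : Γ => ℝ) ⊤, (∀ z : H, R z = S z) ∧ ‖R‖ ≤ ‖S‖ := by
  have key (i : Γ) : ∃ g : StrongDual ℝ E, (∀ z : H, g z = S z i) ∧ ‖g‖ ≤ ‖S‖ := by
    let s : StrongDual ℝ H := LinearMap.mkContinuous
      { toFun := fun z => S z i
        map_add' := fun a b => by simp
        map_smul' := fun c a => by simp } ‖S‖
      (fun z => (lp.norm_apply_le_norm (by simp) (S z) i).trans (S.le_opNorm z))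
    obtain ⟨g, hg, hn⟩ := exists_extension_norm_eq H s
    exact ⟨g, hg, hn.trans_le (LinearMap.mkContinuous_norm_le _ (norm_nonneg S) _)⟩
  choose g hg hn using key
  refine ⟨boundedFamilyToLpInfty g _ hn, fun z => ?_, ?_⟩
  · ext i
    simp [hg]
  · refine ContinuousLinearMap.opNorm_le_bound _ (norm_nonneg S) fun e => ?_
    refine lp.norm_le_of_forall_le (by positivity) fun i => ?_
    exact (g i).le_of_opNorm_le (hn i) e

/-- The evaluation embedding of a normed space into `ℓ^∞` of the unit ball of its dual. -/
noncomputable def dualBallEmbedding (X : Type*) [NormedAddCommGroup X] [NormedSpace ℝ X] :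
    X →L[ℝ] lp (fun _ : Metric.closedBall (0 : StrongDual ℝ X) 1 => ℝ) ⊤ :=
  boundedFamilyToLpInfty (fun φ => (φ : StrongDual ℝ X)) 1 fun φ => mem_closedBall_zero_iff.1 φ.2

theorem norm_dualBallEmbedding (X : Type*) [NormedAddCommGroup X] [NormedSpace ℝ X] (x : X) :
    ‖dualBallEmbedding X x‖ = ‖x‖ := by
  apply le_antisymm
  · refine lp.norm_le_of_forall_le (norm_nonneg _) fun φ => ?_
    simpa [dualBallEmbedding] using
      (φ : StrongDual ℝ X).le_of_opNorm_le (c := 1) (mem_closedBall_zero_iff.1 φ.2) x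
  · obtain ⟨g, hg, hx⟩ := exists_dual_vector'' ℝ x
    have := lp.norm_apply_le_norm (by simp) (dualBallEmbedding X x) ⟨g, by simpa using hg⟩
    simpa [dualBallEmbedding, hx] using this

end LpInfty

/-! ### From stability to uniform left inverses. -/

section Projections

variable {X W : Type u} [NormedAddCommGroup X] [NormedSpace ℝ X]
  [NormedAddCommGroup W] [NormedSpace ℝ W] [CompleteSpace W]

/-- Perturbing an isometric embedding `i` of a universally left-stable space by a bounded map `g`
shows that `i` has a bounded linear left inverse on a subspace containing the ranges of `i`
and `g`. -/
theorem IsUniversallyLeftStable.exists_leftInverse (hX : IsUniversallyLeftStable X)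
    (i : X →ₗᵢ[ℝ] W) (g : X → W) (h0 : g 0 = 0) (hg : ∀ x, ‖g x‖ ≤ 1) :
    ∃ (L : Submodule ℝ W) (T : L →L[ℝ] X), Set.range i ⊆ L ∧ Set.range g ⊆ L ∧
      ∀ (x : X) (hx : i x ∈ L), T ⟨i x, hx⟩ = x := by
  let f : X → W := fun x => i x + g x
  have hf : IsStandardEpsIsometry 2 f := by
    refine ⟨by norm_num, by simp [f, h0], fun x y => ?_⟩
    have h1 : ‖x - y‖ = ‖i x - i y‖ := by rw [← map_sub, i.norm_map]
    rw [h1]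
    refine (abs_norm_sub_norm_le _ _).trans ?_
    have : f x - f y - (i x - i y) = g x - g y := by simp only [f]; abel
    rw [this]
    linarith [norm_sub_le (g x) (g y), hg x, hg y]
  obtain ⟨γ, -, T, hT⟩ := hX W 2 f hf
  let L := closedSpanRange f
  have hclosed : IsClosed (L : Set W) := Submodule.isClosed_topologicalClosure _
  have hfL (x : X) : f x ∈ L := mem_closedSpanRange f x
  have hinv : Tendsto (fun n : ℕ => ((n : ℝ) + 1)⁻¹) atTop (𝓝 0) := by
    simpa using tendsto_one_div_add_atTop_nhds_zero_nat (𝕜 := ℝ)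
  -- Since `g` is bounded, the rescaled values of `f` lose `g` in the limit; likewise the error `γ *
  -- 2` of `T` gets divided by `n + 1`.
  let a (x : X) (n : ℕ) : L := ((n : ℝ) + 1)⁻¹ • ⟨f (((n : ℝ) + 1) • x), hfL _⟩
  have hpos (n : ℕ) : (0 : ℝ) < (n : ℝ) + 1 := by positivity
  have ha (x : X) : Tendsto (fun n => (a x n : W)) atTop (𝓝 (i x)) := by
    rw [tendsto_iff_norm_sub_tendsto_zero]
    refine squeeze_zero (fun _ => norm_nonneg _) (fun n => ?_) hinv
    have : (a x n : W) - i x = ((n : ℝ) + 1)⁻¹ • g (((n : ℝ) + 1) • x) := by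
      simp only [a, f, Submodule.coe_smul, map_smul, smul_add]
      rw [smul_smul, inv_mul_cancel₀ (hpos n).ne']
      simp
    rw [this, norm_smul, Real.norm_of_nonneg (by positivity)]
    exact mul_le_of_le_one_right (by positivity) (hg _)
  have hiL (x : X) : i x ∈ L := hclosed.mem_of_tendsto (ha x) (Eventually.of_forall fun n => (a x n).2)
  refine ⟨L, T, ?_, ?_, fun x hx => ?_⟩
  · rintro _ ⟨x, rfl⟩
    exact hiL x
  · rintro _ ⟨x, rfl⟩
    simpa [f] using L.sub_mem (hfL x) (hiL x)
  · have h1 : Tendsto (fun n => T (a x n)) atTop (𝓝 (T ⟨i x, hx⟩)) :=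
      (T.continuous.tendsto _).comp (tendsto_subtype_rng.2 (ha x))
    refine tendsto_nhds_unique h1 ?_
    rw [tendsto_iff_norm_sub_tendsto_zero]
    refine squeeze_zero (fun _ => norm_nonneg _) (fun n => ?_)
      (by simpa using hinv.mul_const (γ * 2))
    have : T (a x n) - x =
        ((n : ℝ) + 1)⁻¹ • (T ⟨f (((n : ℝ) + 1) • x), hfL _⟩ - ((n : ℝ) + 1) • x) := by
      simp only [a, map_smul, smul_sub]
      rw [smul_smul _ _ x, inv_mul_cancel₀ (hpos n).ne', one_smul]
    rw [this, norm_smul, Real.norm_of_nonneg (by positivity)]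
    exact mul_le_mul_of_nonneg_left (hT _) (by positivity)

/-- In a superspace of a universally left-stable space, adding finitely many vectors leaves the
space uniformly complemented. -/
theorem IsUniversallyLeftStable.exists_uniform_leftInverse (hX : IsUniversallyLeftStable X)
    (i : X →ₗᵢ[ℝ] W) :
    ∃ lam : ℝ, 0 ≤ lam ∧ ∀ s : Set W, s.Finite →
      ∃ P : Submodule.span ℝ (Set.range i ∪ s) →L[ℝ] X, ‖P‖ ≤ lam ∧
        ∀ (x : X) (hx : i x ∈ Submodule.span ℝ (Set.range i ∪ s)), P ⟨i x, hx⟩ = x := by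
  rcases subsingleton_or_nontrivial X with hs | hn
  · exact ⟨0, le_rfl, fun s _ => ⟨0, by simp, fun x _ => Subsingleton.elim _ _⟩⟩
  by_contra! hcon
  -- A bad finite set for each bound `n`; their union is countable, so a single `g` captures it and
  -- a single `T` refutes all large `n`.
  choose s hs hbad using fun n : ℕ => hcon n n.cast_nonneg
  let D : Set W := ⋃ n, s n
  have hD : D.Countable := Set.countable_iUnion fun n => (hs n).countable
  obtain ⟨d, hd⟩ : ∃ d : ℕ → W, D ⊆ Set.range d := by
    rcases D.eq_empty_or_nonempty with h | h
    · exact ⟨fun _ => 0, by simp [h]⟩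
    · obtain ⟨d, hd⟩ := hD.exists_eq_range h
      exact ⟨d, hd.subset⟩
  obtain ⟨x₀, hx₀⟩ := exists_ne (0 : X)
  -- The factor `n + 1` keeps these points away from `0`, where `g` must vanish.
  let p : ℕ → X := fun n => ((n : ℝ) + 1) • x₀
  have hp : Function.Injective p := fun m n h => by
    have := smul_left_injective ℝ hx₀ h
    simpa using this
  let g : X → W := Function.extend p (fun n => (‖d n‖ + 1)⁻¹ • d n) 0
  have hgp (n : ℕ) : g (p n) = (‖d n‖ + 1)⁻¹ • d n := hp.extend_apply _ _ _
  have hg0 : g 0 = 0 := by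
    refine Function.extend_apply' _ _ _ ?_
    rintro ⟨n, hn⟩
    rcases smul_eq_zero.1 hn with h | h
    · exact absurd h (by positivity)
    · exact hx₀ h
  have hg1 (x : X) : ‖g x‖ ≤ 1 := by
    by_cases hx : ∃ n, p n = x
    · obtain ⟨n, rfl⟩ := hx
      rw [hgp, norm_smul, Real.norm_of_nonneg (by positivity), inv_mul_le_iff₀ (by positivity)]
      linarith
    · simp [g, Function.extend_apply' _ _ _ hx]
  obtain ⟨L, T, hiL, hgL, hT⟩ := hX.exists_leftInverse i g hg0 hg1
  have hDL : D ⊆ L := fun w hw => by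
    obtain ⟨n, rfl⟩ := hd hw
    have h1 : g (p n) ∈ L := hgL ⟨_, rfl⟩
    have h2 := L.smul_mem (‖d n‖ + 1) h1
    rwa [hgp, smul_smul, mul_inv_cancel₀ (by positivity), one_smul] at h2
  obtain ⟨n, hn⟩ := exists_nat_ge ‖T‖
  have hle : Submodule.span ℝ (Set.range i ∪ s n) ≤ L :=
    Submodule.span_le.2 (Set.union_subset hiL ((Set.subset_iUnion s n).trans hDL))
  let P : Submodule.span ℝ (Set.range i ∪ s n) →L[ℝ] X :=
    LinearMap.mkContinuous (T.toLinearMap ∘ₗ Submodule.inclusion hle) ‖T‖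
      fun z => T.le_opNorm (Submodule.inclusion hle z)
  obtain ⟨x, hx, hne⟩ := hbad n P
    ((LinearMap.mkContinuous_norm_le _ (norm_nonneg T) _).trans hn)
  exact hne (hT x (hle hx))

/-- Operators from finite-dimensional spaces into a universally left-stable space extend to
larger finite-dimensional spaces with a uniform bound on the norm. -/
theorem IsUniversallyLeftStable.exists_finite_extension (hX : IsUniversallyLeftStable X) :
    ∃ lam : ℝ, 0 ≤ lam ∧ ∀ {E : Type*} [NormedAddCommGroup E] [NormedSpace ℝ E]
      (H : Submodule ℝ E) (S : H →L[ℝ] X) (A : Set E), A.Finite →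
      ∃ U : Submodule.span ℝ A →L[ℝ] X, ‖U‖ ≤ lam * ‖S‖ ∧
        ∀ (z : E) (hz : z ∈ H) (hA : z ∈ Submodule.span ℝ A), U ⟨z, hA⟩ = S ⟨z, hz⟩ := by
  let i : X →ₗᵢ[ℝ] _ := ⟨(dualBallEmbedding X).toLinearMap, norm_dualBallEmbedding X⟩
  obtain ⟨lam, h0, hlam⟩ := hX.exists_uniform_leftInverse i
  refine ⟨lam, h0, fun H S A hA => ?_⟩
  obtain ⟨R, hR, hRn⟩ := exists_extension_lpInfty H (i.toContinuousLinearMap ∘L S)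
  obtain ⟨P, hPn, hP⟩ := hlam (R '' A) (hA.image R)
  have hmem (z : Submodule.span ℝ A) : R z ∈ Submodule.span ℝ (Set.range i ∪ R '' A) := by
    refine Submodule.span_mono Set.subset_union_right ?_
    have := Submodule.mem_map_of_mem (f := R.toLinearMap) z.2
    rwa [Submodule.map_span] at this
  have hRS : ‖R‖ ≤ ‖S‖ := hRn.trans <| ContinuousLinearMap.opNorm_le_bound _ (norm_nonneg S)
    fun z => by simpa using S.le_opNorm z
  refine ⟨LinearMap.mkContinuous (P.toLinearMap ∘ₗ
    LinearMap.codRestrict _ (R.toLinearMap ∘ₗ Submodule.subtype _) hmem) (lam * ‖S‖) fun z => ?_,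
    LinearMap.mkContinuous_norm_le _ (by positivity) _, fun z hz hzA => ?_⟩
  · refine (P.le_of_opNorm_le hPn _).trans ?_
    rw [mul_assoc]
    refine mul_le_mul_of_nonneg_left ?_ h0
    exact R.le_of_opNorm_le hRS z
  · have h1 : R z = i (S ⟨z, hz⟩) := hR ⟨z, hz⟩
    refine Eq.trans ?_ (hP (S ⟨z, hz⟩) (h1 ▸ hmem ⟨z, hzA⟩))
    exact congrArg P (Subtype.ext h1)

end Projections

/-! ### Approximating operators into the bidual by operators into the space. -/

section LocalReflexivity

variable {X : Type*} [NormedAddCommGroup X] [NormedSpace ℝ X]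

/-- The dual of a finite sup-norm sum is the `ℓ^1`-sum of the duals: nearly norming vectors, one per
coordinate with signs adjusted, form one vector of the unit ball. -/
theorem sum_norm_single_le {ι : Type*} [Fintype ι] [DecidableEq ι] (ψ : StrongDual ℝ (ι → X)) :
    ∑ k, ‖ψ ∘L ContinuousLinearMap.single ℝ (fun _ : ι => X) k‖ ≤ ‖ψ‖ := by
  refine le_of_forall_pos_le_add fun δ hδ => ?_
  have hN : (0 : ℝ) < Fintype.card ι + 1 := by positivity
  have key (k : ι) : ∃ x : X, ‖x‖ ≤ 1 ∧
      ‖ψ ∘L ContinuousLinearMap.single ℝ (fun _ : ι => X) k‖ - δ / (Fintype.card ι + 1)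
        ≤ ψ (Pi.single k x) := by
    set θ := ψ ∘L ContinuousLinearMap.single ℝ (fun _ : ι => X) k with hθ
    obtain ⟨x, hx, hlt⟩ := θ.exists_lt_apply_of_lt_opNorm
      (r := ‖θ‖ - δ / (Fintype.card ι + 1)) (by have := div_pos hδ hN; linarith)
    have hx' : ∀ x, θ x = ψ (Pi.single k x) := fun x => rfl
    rcases le_total 0 (θ x) with h | h
    · rw [Real.norm_of_nonneg h] at hlt
      exact ⟨x, hx.le, hx' x ▸ hlt.le⟩
    · rw [Real.norm_of_nonpos h] at hlt
      refine ⟨-x, by simpa using hx.le, ?_⟩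
      rw [← hx', map_neg]
      exact hlt.le
  choose x hx hlt using key
  have h1 : ψ x ≤ ‖ψ‖ := by
    refine (le_abs_self _).trans ((ψ.le_opNorm x).trans ?_)
    exact mul_le_of_le_one_right (norm_nonneg _) ((pi_norm_le_iff_of_nonneg zero_le_one).2 hx)
  have h2 : ψ x = ∑ k, ψ (Pi.single k (x k)) := by
    rw [← map_sum, Finset.univ_sum_single]
  have h3 := Finset.sum_le_sum fun k (_ : k ∈ Finset.univ) => hlt k
  rw [Finset.sum_sub_distrib, ← h2] at h3
  have h4 : ∑ _k : ι, δ / ((Fintype.card ι : ℝ) + 1) ≤ δ := by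
    rw [Finset.sum_const, Finset.card_univ, nsmul_eq_mul, mul_div_assoc', div_le_iff₀ hN]
    linarith
  linarith

/-- In finite dimension the operator norm is computed, up to a factor `2`, on finitely many
vectors of the unit ball. -/
theorem exists_finset_opNorm_le (H : Type*) [NormedAddCommGroup H] [NormedSpace ℝ H]
    [FiniteDimensional ℝ H] :
    ∃ N : Finset H, (∀ h ∈ N, ‖h‖ ≤ 1) ∧ ∀ (S : H →L[ℝ] X) (c : ℝ), 0 ≤ c →
      (∀ h ∈ N, ‖S h‖ ≤ c) → ‖S‖ ≤ 2 * c := by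
  have : ProperSpace H := FiniteDimensional.proper ℝ H
  obtain ⟨t, hts, htf, hcov⟩ :=
    (isCompact_closedBall (0 : H) 1).finite_cover_balls (e := 1 / 2) (by norm_num)
  refine ⟨htf.toFinset, fun h hh => by simpa using hts (htf.mem_toFinset.1 hh),
    fun S c hc hS => ?_⟩
  have hS2 : ‖S‖ ≤ c + ‖S‖ * (1 / 2) := by
    refine S.opNorm_le_of_unit_norm (by positivity) fun h hh => ?_
    obtain ⟨k, hk, hkh⟩ := Set.mem_iUnion₂.1 (hcov (show h ∈ Metric.closedBall 0 1 by simp [hh]))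
    have : S h = S k + S (h - k) := by simp
    rw [this]
    refine (norm_add_le _ _).trans (add_le_add (hS k (htf.mem_toFinset.2 hk)) ?_)
    refine (S.le_opNorm _).trans (mul_le_mul_of_nonneg_left ?_ (norm_nonneg _))
    exact (mem_ball_iff_norm.1 hkh).le
  linarith

variable {H : Type*} [NormedAddCommGroup H] [NormedSpace ℝ H] [FiniteDimensional ℝ H]

/-- The functional on `(H →L X)*` induced by an operator `H →L X**`. -/
noncomputable def bidualPairing (T : H →L[ℝ] StrongDual ℝ (StrongDual ℝ X)) :
    StrongDual ℝ (H →L[ℝ] X) →ₗ[ℝ] ℝ :=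
  ∑ l, (T (Module.finBasis ℝ H l)).toLinearMap ∘ₗ
    { toFun := fun u => u ∘L ContinuousLinearMap.smulRightL ℝ H X
        ((Module.finBasis ℝ H).coord l).toContinuousLinearMap
      map_add' := fun _ _ => rfl
      map_smul' := fun _ _ => rfl }

/-- Evaluations `S ↦ φ (S h)` span `(H →L X)*`, so this identity determines the pairing and makes it
independent of the basis. -/
theorem bidualPairing_eval (T : H →L[ℝ] StrongDual ℝ (StrongDual ℝ X)) (φ : StrongDual ℝ X)
    (h : H) : bidualPairing T (φ ∘L ContinuousLinearMap.apply ℝ X h) = T h φ := by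
  have h1 (l) : (φ ∘L ContinuousLinearMap.apply ℝ X h) ∘L ContinuousLinearMap.smulRightL ℝ H X
      ((Module.finBasis ℝ H).coord l).toContinuousLinearMap
      = (Module.finBasis ℝ H).repr h l • φ := by
    ext x
    simp
  have h2 : T h = ∑ l, (Module.finBasis ℝ H).repr h l • T (Module.finBasis ℝ H l) := by
    conv_lhs => rw [← (Module.finBasis ℝ H).sum_repr h]
    simp only [map_sum, map_smul]
  simp only [bidualPairing, LinearMap.sum_apply, LinearMap.comp_apply, h2, sum_apply, smul_apply]
  exact Finset.sum_congr rfl fun l _ => (congrArg (T _) (h1 l)).trans (map_smul (T _) _ _)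

/-- A weak form of the principle of local reflexivity. -/
theorem exists_approx_of_bidual (T : H →L[ℝ] StrongDual ℝ (StrongDual ℝ X))
    (A : Finset H) (B : Finset (StrongDual ℝ X)) {δ : ℝ} (hδ : 0 < δ) :
    ∃ S : H →L[ℝ] X, ‖S‖ ≤ 2 * ‖T‖ ∧ ∀ a ∈ A, ∀ φ ∈ B, |φ (S a) - T a φ| ≤ δ := by
  classical
  rcases eq_or_ne T 0 with rfl | hT0
  · exact ⟨0, by simp, fun a _ φ _ => by simpa using hδ.le⟩
  have hc : 0 < ‖T‖ := norm_pos_iff.2 hT0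
  obtain ⟨N, hN1, hN⟩ := exists_finset_opNorm_le (X := X) H
  let 𝒜 : (H →L[ℝ] X) →ₗ[ℝ] (N → X) :=
    LinearMap.pi fun k => (ContinuousLinearMap.apply ℝ X (k : H)).toLinearMap
  have h𝒜 (S : H →L[ℝ] X) : ‖S‖ ≤ 2 * ‖𝒜 S‖ :=
    hN S _ (norm_nonneg _) fun h hh => norm_le_pi_norm (𝒜 S) ⟨h, hh⟩
  have hinj : Function.Injective 𝒜 := by
    rw [injective_iff_map_eq_zero]
    intro S hS
    have := h𝒜 S
    rw [hS, norm_zero, mul_zero] at this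
    exact norm_le_zero_iff.1 this
  let ι := A × B
  let ev : ι → StrongDual ℝ (H →L[ℝ] X) := fun j =>
    (j.2 : StrongDual ℝ X) ∘L ContinuousLinearMap.apply ℝ X (j.1 : H)
  let Φ : (H →L[ℝ] X) →L[ℝ] (ι → ℝ) := ContinuousLinearMap.pi ev
  let ball : Set (H →L[ℝ] X) := {S | ‖𝒜 S‖ ≤ ‖T‖}
  have hball : Convex ℝ ball := by
    have := (convex_closedBall (0 : N → X) ‖T‖).linear_preimage 𝒜
    simpa [ball, Set.preimage, Metric.closedBall] using this
  let pt : ι → ℝ := fun j => T (j.1 : H) j.2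
  -- Helly's argument: a functional separating `pt` from the image of the ball pulls back to `u`,
  -- with `u ≤ r` on the ball, while its pairing with `T` exceeds `r`.
  have hpt : pt ∈ closure (Φ '' ball) := by
    by_contra hnot
    obtain ⟨f, r, hfr, hrp⟩ := geometric_hahn_banach_closed_point
      (hball.linear_image Φ.toLinearMap).closure isClosed_closure hnot
    let u : StrongDual ℝ (H →L[ℝ] X) := f ∘L Φ
    have hu_ball (S : H →L[ℝ] X) (hS : ‖𝒜 S‖ ≤ ‖T‖) : u S ≤ r :=
      (hfr _ (subset_closure ⟨S, hS, rfl⟩)).le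
    have hr : 0 ≤ r := by simpa using hu_ball 0 (by simp)
    have hu (S : H →L[ℝ] X) : ‖u S‖ ≤ r / ‖T‖ * ‖𝒜 S‖ := by
      have half (S : H →L[ℝ] X) : u S ≤ r / ‖T‖ * ‖𝒜 S‖ := by
        rcases eq_or_ne S 0 with rfl | hS
        · simp
        have hp : 0 < ‖𝒜 S‖ := norm_pos_iff.2 ((map_ne_zero_iff _ hinj).2 hS)
        have := hu_ball ((‖T‖ / ‖𝒜 S‖) • S) (by
          rw [map_smul, norm_smul, Real.norm_of_nonneg (by positivity),
            div_mul_cancel₀ _ hp.ne'])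
        rw [map_smul, smul_eq_mul, div_mul_eq_mul_div, div_le_iff₀ hp] at this
        rw [div_mul_eq_mul_div, le_div_iff₀ hc]
        linarith
      rw [Real.norm_eq_abs, abs_le]
      refine ⟨?_, half S⟩
      have := half (-S)
      simp only [map_neg, norm_neg] at this
      linarith
    -- Hahn–Banach extends `u` from the range of `𝒜` to all of `N → X`. Its coordinates `ψk` have
    -- total norm at most `r / ‖T‖`, so the pairing of `u` with `T` is at most `r`.
    let e := LinearEquiv.ofInjective 𝒜 hinj
    let ψ₀ : StrongDual ℝ (LinearMap.range 𝒜) :=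
      LinearMap.mkContinuous (u.toLinearMap ∘ₗ e.symm.toLinearMap) (r / ‖T‖) fun z => by
        have := hu (e.symm z)
        have h2 : 𝒜 (e.symm z) = z := congrArg Subtype.val (e.apply_symm_apply z)
        rw [h2] at this
        exact this
    obtain ⟨ψ, hψ, hψn⟩ := exists_extension_norm_eq (LinearMap.range 𝒜) ψ₀
    have hψr : ‖ψ‖ ≤ r / ‖T‖ :=
      hψn.trans_le (LinearMap.mkContinuous_norm_le _ (by positivity) _)
    have hψu (S : H →L[ℝ] X) : ψ (𝒜 S) = u S := by
      have h1 := hψ (e S)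
      have h2 : ψ₀ (e S) = u S := congrArg u (e.symm_apply_apply S)
      rw [← h2, ← h1]
      rfl
    let ψk (k : N) : StrongDual ℝ X := ψ ∘L ContinuousLinearMap.single ℝ (fun _ : N => X) k
    have hu_sum : u = ∑ k, ψk k ∘L ContinuousLinearMap.apply ℝ X (k : H) := by
      ext S
      rw [← hψu]
      conv_lhs => rw [← Finset.univ_sum_single (𝒜 S)]
      simp [ψk, 𝒜]
    have hle : bidualPairing T u ≤ r := by
      rw [hu_sum, map_sum]
      simp only [bidualPairing_eval]
      calc ∑ k : N, T (k : H) (ψk k) ≤ ∑ k : N, ‖T‖ * ‖ψk k‖ := by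
            refine Finset.sum_le_sum fun k _ => (le_abs_self _).trans ?_
            refine ((T k).le_opNorm _).trans (mul_le_mul_of_nonneg_right ?_ (norm_nonneg _))
            exact (T.le_opNorm _).trans (mul_le_of_le_one_right hc.le (hN1 k k.2))
        _ = ‖T‖ * ∑ k : N, ‖ψk k‖ := by rw [Finset.mul_sum]
        _ ≤ ‖T‖ * (r / ‖T‖) :=
            mul_le_mul_of_nonneg_left ((sum_norm_single_le ψ).trans hψr) hc.le
        _ = r := mul_div_cancel₀ _ hc.ne'
    have hf (v : ι → ℝ) : f v = ∑ j, v j * f (Pi.single j 1) := by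
      conv_lhs => rw [← Finset.univ_sum_single v]
      rw [map_sum]
      refine Finset.sum_congr rfl fun j _ => ?_
      rw [← smul_eq_mul, ← map_smul, ← Pi.single_smul, smul_eq_mul, mul_one]
    have hu_ev : u = ∑ j, f (Pi.single j 1) • ev j := by
      ext S
      simp only [u, ContinuousLinearMap.comp_apply, hf (Φ S), sum_apply,
        smul_apply, smul_eq_mul]
      exact Finset.sum_congr rfl fun j _ => mul_comm _ _
    have heq : bidualPairing T u = f pt := by
      rw [hu_ev, map_sum, hf pt]
      refine Finset.sum_congr rfl fun j _ => ?_
      rw [map_smul, smul_eq_mul, mul_comm, bidualPairing_eval]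
    linarith
  obtain ⟨_, ⟨S, hS, rfl⟩, hd⟩ := Metric.mem_closure_iff.1 hpt δ hδ
  refine ⟨S, hN S _ hc.le fun h hh => (norm_le_pi_norm (𝒜 S) ⟨h, hh⟩).trans hS,
    fun a ha φ hφ => ?_⟩
  have := (dist_le_pi_dist pt (Φ S) (⟨a, ha⟩, ⟨φ, hφ⟩)).trans hd.le
  rw [dist_comm, Real.dist_eq] at this
  exact this

end LocalReflexivity

/-! ### Ultralimits and injectivity of the bidual. -/

section BidualExtension

variable {X : Type u} [NormedAddCommGroup X] [NormedSpace ℝ X]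

/-- A bounded net in `X` that is eventually additive and homogeneous, together with an
ultrafilter, defines an operator into `X**`. -/
theorem exists_ultralimit_bidual {E : Type v} [NormedAddCommGroup E] [NormedSpace ℝ E]
    {ι : Type*} (𝒰 : Ultrafilter ι) (q : ι → E → X) {C : ℝ} (hC : 0 ≤ C)
    (hq : ∀ j e, ‖q j e‖ ≤ C * ‖e‖)
    (hadd : ∀ a b, ∀ᶠ j in 𝒰, q j (a + b) = q j a + q j b)
    (hsmul : ∀ (c : ℝ) a, ∀ᶠ j in 𝒰, q j (c • a) = c • q j a) :
    ∃ S : E →L[ℝ] StrongDual ℝ (StrongDual ℝ X), ‖S‖ ≤ C ∧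
      ∀ e φ, Tendsto (fun j => φ (q j e)) 𝒰 (𝓝 (S e φ)) := by
  have hbound (e : E) (φ : StrongDual ℝ X) (j : ι) : ‖φ (q j e)‖ ≤ C * ‖e‖ * ‖φ‖ :=
    (φ.le_opNorm _).trans (by
      rw [mul_comm]
      exact mul_le_mul_of_nonneg_right (hq j e) (norm_nonneg _))
  have hlim (e : E) (φ : StrongDual ℝ X) : ∃ l ∈ Metric.closedBall (0 : ℝ) (C * ‖e‖ * ‖φ‖),
      Tendsto (fun j => φ (q j e)) 𝒰 (𝓝 l) := by
    refine (isCompact_closedBall (0 : ℝ) (C * ‖e‖ * ‖φ‖)).ultrafilter_le_nhds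
      (𝒰.map fun j => φ (q j e)) ?_
    rw [le_principal_iff]
    exact (Eventually.of_forall fun j => mem_closedBall_zero_iff.2 (hbound e φ j) :
      ∀ᶠ j in (𝒰 : Filter ι), φ (q j e) ∈ Metric.closedBall (0 : ℝ) (C * ‖e‖ * ‖φ‖))
  choose l hl hlt using hlim
  let B : E →ₗ[ℝ] StrongDual ℝ X →ₗ[ℝ] ℝ := LinearMap.mk₂ ℝ l
    (fun a b φ => tendsto_nhds_unique (hlt (a + b) φ) <| by
      refine ((hlt a φ).add (hlt b φ)).congr' ?_
      filter_upwards [hadd a b] with j hj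
      rw [hj, map_add])
    (fun c a φ => tendsto_nhds_unique (hlt (c • a) φ) <| by
      refine ((hlt a φ).const_smul c).congr' ?_
      filter_upwards [hsmul c a] with j hj
      rw [hj, map_smul])
    (fun a φ ψ => tendsto_nhds_unique (hlt a (φ + ψ)) ((hlt a φ).add (hlt a ψ)))
    (fun c a φ => tendsto_nhds_unique (hlt a (c • φ)) ((hlt a φ).const_smul c))
  exact ⟨B.mkContinuous₂ C fun e φ => mem_closedBall_zero_iff.1 (hl e φ),
    LinearMap.mkContinuous₂_norm_le _ hC _, hlt⟩

theorem IsUniversallyLeftStable.isInjectiveBanach_bidual (hX : IsUniversallyLeftStable X) :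
    IsInjectiveBanach.{u, v} (StrongDual ℝ (StrongDual ℝ X)) := by
  classical
  obtain ⟨lam, h0, hlam⟩ := hX.exists_finite_extension
  refine ⟨max 1 (lam * 2), le_max_left _ _, ?_⟩
  intro E _ _ _ F _ T
  -- Finite sets of vectors, finite sets of functionals, and a precision `1 / (n + 1)`.
  let ι := Finset E × Finset (StrongDual ℝ X) × ℕ
  have key (j : ι) : ∃ U : Submodule.span ℝ (j.1 : Set E) →L[ℝ] X, ‖U‖ ≤ lam * 2 * ‖T‖ ∧
      ∀ (z : F) (hz : (z : E) ∈ j.1), ∀ φ ∈ j.2.1,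
        |φ (U ⟨z, Submodule.subset_span hz⟩) - T z φ| ≤ 1 / ((j.2.2 : ℝ) + 1) := by
    let G : Submodule ℝ E := Submodule.span ℝ (j.1 : Set E)
    have : FiniteDimensional ℝ G := FiniteDimensional.span_finset ℝ j.1
    let H : Submodule ℝ E := F ⊓ G
    have : FiniteDimensional ℝ H := Submodule.finiteDimensional_of_le inf_le_right
    let TH : H →L[ℝ] StrongDual ℝ (StrongDual ℝ X) :=
      LinearMap.mkContinuous (T.toLinearMap ∘ₗ Submodule.inclusion inf_le_left) ‖T‖
        fun z => T.le_opNorm (Submodule.inclusion inf_le_left z)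
    have hTH : ‖TH‖ ≤ ‖T‖ := LinearMap.mkContinuous_norm_le _ (norm_nonneg T) _
    let A : Finset H := j.1.preimage Subtype.val Subtype.val_injective.injOn
    obtain ⟨S, hS, hSA⟩ := exists_approx_of_bidual TH A j.2.1
      (δ := 1 / ((j.2.2 : ℝ) + 1)) (by positivity)
    obtain ⟨U, hU, hUS⟩ := hlam H S (j.1 : Set E) j.1.finite_toSet
    refine ⟨U, hU.trans ?_, fun z hz φ hφ => ?_⟩
    · rw [mul_assoc]
      exact mul_le_mul_of_nonneg_left (hS.trans (by linarith)) h0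
    · have hzG : (z : E) ∈ G := Submodule.subset_span hz
      rw [hUS z ⟨z.2, hzG⟩ hzG]
      exact hSA ⟨z, z.2, hzG⟩ (by simpa [A] using hz) φ hφ
  choose U hU hUT using key
  -- The value `0` off the span destroys linearity, but each vector eventually lies in the span.
  let q (j : ι) (e : E) : X :=
    if he : e ∈ Submodule.span ℝ (j.1 : Set E) then U j ⟨e, he⟩ else 0
  have hq_eq (j : ι) (e : E) (he : e ∈ Submodule.span ℝ (j.1 : Set E)) :
      q j e = U j ⟨e, he⟩ := dif_pos he
  have hC : 0 ≤ lam * 2 * ‖T‖ := by positivity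
  have hq (j : ι) (e : E) : ‖q j e‖ ≤ lam * 2 * ‖T‖ * ‖e‖ := by
    by_cases he : e ∈ Submodule.span ℝ (j.1 : Set E)
    · rw [hq_eq j e he]
      exact (U j).le_of_opNorm_le (hU j) _
    · simp only [q, dif_neg he, norm_zero]
      positivity
  let 𝒰 : Ultrafilter ι := Ultrafilter.of atTop
  have hle : (𝒰 : Filter ι) ≤ atTop := Ultrafilter.of_le _
  have hmem (e : E) : ∀ᶠ j in (𝒰 : Filter ι), e ∈ j.1 := by
    filter_upwards [hle (mem_atTop (({e}, ∅, 0) : ι))] with j hj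
    exact hj.1 (Finset.mem_singleton_self e)
  have hspan (e : E) : ∀ᶠ j in (𝒰 : Filter ι), e ∈ Submodule.span ℝ (j.1 : Set E) :=
    (hmem e).mono fun j hj => Submodule.subset_span hj
  obtain ⟨S, hSn, hS⟩ := exists_ultralimit_bidual 𝒰 q hC hq
    (fun a b => by
      filter_upwards [hspan a, hspan b] with j ha hb
      rw [hq_eq j a ha, hq_eq j b hb, hq_eq j _ (Submodule.add_mem _ ha hb), ← map_add]
      rfl)
    (fun c a => by
      filter_upwards [hspan a] with j ha
      rw [hq_eq j a ha, hq_eq j _ (Submodule.smul_mem _ c ha), ← map_smul]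
      rfl)
  refine ⟨S, fun z => ?_, hSn.trans
    (mul_le_mul_of_nonneg_right (le_max_right _ _) (norm_nonneg T))⟩
  ext φ
  refine tendsto_nhds_unique (hS z φ) ?_
  rw [tendsto_iff_norm_sub_tendsto_zero]
  have hn : Tendsto (fun j : ι => 1 / ((j.2.2 : ℝ) + 1)) 𝒰 (𝓝 0) :=
    tendsto_one_div_add_atTop_nhds_zero_nat.comp
      ((tendsto_atTop.2 fun n => by
        filter_upwards [hle (mem_atTop ((∅, ∅, n) : ι))] with j hj
        exact hj.2.2) : Tendsto (fun j : ι => j.2.2) 𝒰 atTop)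
  refine squeeze_zero' (Eventually.of_forall fun _ => norm_nonneg _) ?_ hn
  filter_upwards [hmem z, hle (mem_atTop ((∅, {φ}, 0) : ι))] with j hj hφ
  rw [hq_eq j z (Submodule.subset_span hj)]
  exact hUT j z hj φ (hφ.2.1 (Finset.mem_singleton_self φ))

/-- Injectivity passes to spaces that factor through an injective space. -/
theorem IsInjectiveBanach.of_leftInverse {Z : Type*} [NormedAddCommGroup Z] [NormedSpace ℝ Z]
    (hZ : IsInjectiveBanach.{_, v} Z) (J : X →L[ℝ] Z) (π : Z →L[ℝ] X) (h : ∀ x, π (J x) = x) :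
    IsInjectiveBanach.{u, v} X := by
  obtain ⟨lam, h1, hlam⟩ := hZ
  refine ⟨max 1 (‖π‖ * (lam * ‖J‖)), le_max_left _ _, fun E _ _ _ F hF T => ?_⟩
  obtain ⟨S, hS, hSn⟩ := hlam E F hF (J ∘L T)
  refine ⟨π ∘L S, fun z => ?_, ?_⟩
  · simp [hS, h]
  · calc ‖π ∘L S‖ ≤ ‖π‖ * ‖S‖ := ContinuousLinearMap.opNorm_comp_le _ _
      _ ≤ ‖π‖ * (lam * (‖J‖ * ‖T‖)) := by
          refine mul_le_mul_of_nonneg_left (hSn.trans ?_) (norm_nonneg π)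
          exact mul_le_mul_of_nonneg_left (ContinuousLinearMap.opNorm_comp_le _ _) (by linarith)
      _ = ‖π‖ * (lam * ‖J‖) * ‖T‖ := by ring
      _ ≤ _ := mul_le_mul_of_nonneg_right (le_max_right _ _) (norm_nonneg T)

/-- A space isomorphic to a dual is complemented in its bidual. -/
theorem IsIsomorphicToDual.exists_leftInverse_inclusionInDoubleDual
    (h : IsIsomorphicToDual.{u, w} X) :
    ∃ π : StrongDual ℝ (StrongDual ℝ X) →L[ℝ] X,
      ∀ x, π (NormedSpace.inclusionInDoubleDual ℝ X x) = x := by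
  obtain ⟨M, _, _, _, ⟨e⟩⟩ := h
  let evalM : M →L[ℝ] StrongDual ℝ X := (e : X →L[ℝ] StrongDual ℝ M).flip
  -- Restrict a bidual element along `M → X*`, the predual map of `e`, then return by `e.symm`.
  refine ⟨(e.symm : StrongDual ℝ M →L[ℝ] X) ∘L
    (ContinuousLinearMap.compL ℝ M (StrongDual ℝ X) ℝ).flip evalM, fun x => ?_⟩
  refine e.injective ?_
  ext m
  simp [evalM]

end BidualExtension

end

theorem theorem3p11 (X : Type u) [NormedAddCommGroup X] [NormedSpace ℝ X] [CompleteSpace X]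
    (hX : IsUniversallyLeftStable.{u} X) :
    IsInjectiveBanach.{u, v} (StrongDual ℝ (StrongDual ℝ X)) ∧
      (IsIsomorphicToDual.{u, w} X → IsInjectiveBanach.{u, v} X) := by
  refine ⟨hX.isInjectiveBanach_bidual, fun h => ?_⟩
  obtain ⟨π, hπ⟩ := h.exists_leftInverse_inclusionInDoubleDual
  exact hX.isInjectiveBanach_bidual.of_leftInverse _ π hπ
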